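/- A binar is a set $A$ with a single binary operation; a term is a formal product of variables, and an identity holds in $A$ if it is true for all values of its variables in $A$. For an integer $k>1$, a $(k+1)$-ary term $t$ is a $k$-edge term for $A$ if the following $k$ identities hold in $A$: $$t(y,y,x,x,x,\dots,x)\approx x,\quad t(y,x,y,x,x,\dots,x)\approx x,\quad t(x,x,x,y,x,\dots,x)\approx x,\ \dots,\ t(x,x,x,x,x,\dots,y)\approx x$$ (from the third identity on, $y$ occurs exactly once, successively in the 4th, 5th, …, $(k+1)$-st position). $A$ has an edge term if it has a $k$-edge term for some $k>1$. Let $\mathsf{HS}(A)$ be the class of homomorphic images of subalgebras of $A$, and let $V(A)$ be the variety generated by $A$, i.e. the class of homomorphic images of subalgebras of direct powers of $A$; $V(A)$ is congruence modular if every member of $V(A)$ has a modular congruence lattice. Let $S_2=\langle\{0,1\},\wedge\rangle$ be the two-element semilattice. A cube-term blocker for $A$ is a pair $(D,S)$ of subuniverses of $A$ with $\emptyset\neq D\subsetneq S\subseteq A$ such that for every term $t(x_0,\dots,x_{n-1})$ there is an index $i<n$ such that, for all $(s_0,\dots,s_{n-1})\in S^n$, if $s_i\in D$ then $t(s_0,\dots,s_{n-1})\in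 D$. **Theorem.** Let $A$ be a finite binar whose operation is commutative and idempotent. Then the following are equivalent: 1. $A$ has an edge term; 2. $V(A)$ is congruence modular; 3. $S_2\notin\mathsf{HS}(A)$. Moreover, $A$ has a cube-term blocker if and only if $S_2\in\mathsf{HS}(A)$. -/

import Mathlib

/-!
A binar (an algebra with one binary operation) is a type with a `Mul` instance.
Subuniverses of a binar are `Subsemigroup`s (for a bare `Mul` these are just the subsets closed
under the operation), homomorphisms are `→ₙ*`, congruences are `Con`, and direct powers are
function types `I → A` with the pointwise operation.
-/

universe u v

namespace Binar

/-- The `n`-ary terms in the language of one binary operation. -/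
abbrev Term (n : ℕ) : Type := FreeMagma (Fin n)

/-- The value of the term `t` at the tuple `a` of elements of `A`. -/
def Term.eval {A : Type u} [Mul A] {n : ℕ} (t : Term n) (a : Fin n → A) : A :=
  FreeMagma.lift a t

/-- The `(k+1)`-ary term `t` satisfies in `A` the `k` identities of a `k`-edge term (`k > 1`):
`t(y,y,x,x,…,x) ≈ x`, `t(y,x,y,x,…,x) ≈ x`, and, for each of the positions `3, …, k`
(counted from `0`), `t(x,…,x,y,x,…,x) ≈ x` with `y` at that position. -/
structure IsEdgeTerm (A : Type u) [Mul A] (k : ℕ) (t : Term (k + 1)) : Prop where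
  one_lt : 1 < k
  first : ∀ x y : A, t.eval (fun i => if i.val = 0 ∨ i.val = 1 then y else x) = x
  second : ∀ x y : A, t.eval (fun i => if i.val = 0 ∨ i.val = 2 then y else x) = x
  rest : ∀ j : Fin (k + 1), 3 ≤ j.val →
    ∀ x y : A, t.eval (fun i => if i = j then y else x) = x

/-- `A` has an edge term. -/
def HasEdgeTerm (A : Type u) [Mul A] : Prop :=
  ∃ (k : ℕ) (t : Term (k + 1)), IsEdgeTerm A k t

/-- `B ∈ HS(A)`: `B` is a homomorphic image of a subalgebra of `A`. -/
def InHS (A : Type u) [Mul A] (B : Type v) [Mul B] : Prop :=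
  ∃ (S : Subsemigroup A) (f : S →ₙ* B), Function.Surjective f

/-- `B ∈ V(A) = HSP(A)`: `B` is a homomorphic image of a subalgebra of a direct power of `A`. -/
def InVariety (A : Type u) [Mul A] (B : Type v) [Mul B] : Prop :=
  ∃ I : Type (max u v), InHS (I → A) B

/-- The variety `V(A)` is congruence modular: every member of `V(A)` has a modular lattice of
congruences. -/
def VarietyIsCongruenceModular (A : Type u) [Mul A] : Prop :=
  ∀ (B : Type v) [Mul B], InVariety A B → IsModularLattice (Con B)

/-- The universe `{0, 1}` of the two-element semilattice. -/
def S2 : Type := Fin 2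

/-- The operation of the two-element semilattice is the meet. -/
instance : Mul S2 where
  mul a b := (min (show Fin 2 from a) (show Fin 2 from b) : Fin 2)

/-- `(D, S)` is a cube-term blocker for `A`: `∅ ≠ D ⊊ S ≤ A` are subuniverses, and every term
has a coordinate `i` such that its value at a tuple of `S` is in `D` as soon as the `i`-th entry
of the tuple is in `D`. -/
structure IsCubeTermBlocker (A : Type u) [Mul A] (D S : Subsemigroup A) : Prop where
  nonempty : (D : Set A).Nonempty
  lt : D < S
  blocks : ∀ (n : ℕ) (t : Term n), ∃ i : Fin n,
    ∀ s : Fin n → A, (∀ j, s j ∈ S) → s i ∈ D → t.eval s ∈ D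

/-- `A` has a cube-term blocker. -/
def HasCubeTermBlocker (A : Type u) [Mul A] : Prop :=
  ∃ D S : Subsemigroup A, IsCubeTermBlocker A D S

end Binar

namespace Binar

/-! ### Term evaluation, homomorphisms and substitution -/

section Terms

variable {A : Type u} [Mul A] {n : ℕ}

/-! The hub is `SemilatticeFree`, which follows from the absence of `S2` in `HS(A)`. It passes to
finite powers and subalgebras, hence to the two-generated free algebra `B` of the variety, a
subalgebra of `A ^ (A × A)`. Let `Z ≤ B × B` be generated by `(y, y)`, `(y, x)`, `(x, y)`. By
idempotence it contains a full row and a full column through `(y, y)`, so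
`SemilatticeFree.mem_of_cross` puts `(x, x)` in `Z`. The term producing `(x, x)` is a 2-edge term,
that is, a Maltsev term up to the order of variables; it makes congruences permute, hence gives
modularity. Conversely, `S2` in `HS(A)` yields a cube-term blocker, which excludes edge terms, and
puts `S2 × S2`, whose congruence lattice is not modular, in the variety. -/

theorem Term.eval_mul (p q : Term n) (a : Fin n → A) :
    Term.eval (p * q : Term n) a = p.eval a * q.eval a := rfl

theorem Term.map_eval {B : Type v} [Mul B] (f : A →ₙ* B) (t : Term n) (a : Fin n → A) :
    f (t.eval a) = t.eval (fun i => f (a i)) := by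
  induction t using FreeMagma.recOnMul with
  | ih1 i => rfl
  | ih2 p q hp hq => rw [Term.eval_mul, Term.eval_mul, map_mul, hp, hq]

theorem Term.eval_mem (S : Subsemigroup A) (t : Term n) {a : Fin n → A} (ha : ∀ i, a i ∈ S) :
    t.eval a ∈ S := by
  induction t using FreeMagma.recOnMul with
  | ih1 i => exact ha i
  | ih2 p q hp hq => exact S.mul_mem hp hq

theorem Term.eval_const (hidem : ∀ x : A, x * x = x) (t : Term n) (x : A) :
    t.eval (fun _ => x) = x := by
  induction t using FreeMagma.recOnMul with
  | ih1 i => rfl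
  | ih2 p q hp hq => rw [Term.eval_mul, hp, hq, hidem]

theorem Term.eval_con (c : Con A) (t : Term n) {a b : Fin n → A} (h : ∀ i, c (a i) (b i)) :
    c (t.eval a) (t.eval b) := by
  induction t using FreeMagma.recOnMul with
  | ih1 i => exact h i
  | ih2 p q hp hq => exact c.mul hp hq

/-- Substitution of terms for the variables of a term. -/
theorem Term.eval_subst {m : ℕ} (t : Term n) (r : Fin n → Term m) (a : Fin m → A) :
    Term.eval (t.eval r : Term m) a = t.eval (fun i => (r i).eval a) :=
  Term.map_eval (FreeMagma.lift a) t r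

theorem Term.eval_apply {Q : Type v} (t : Term n) (a : Fin n → Q → A) (q : Q) :
    t.eval a q = t.eval (fun i => a i q) :=
  Term.map_eval (⟨fun f => f q, fun _ _ => rfl⟩ : (Q → A) →ₙ* A) t a

end Terms

/-- No subalgebra of `A` has the form `D ∪ {s}` with `D` a nonempty subuniverse, `s ∉ D`
and `s * D ⊆ D`. -/
def SemilatticeFree (A : Type u) [Mul A] : Prop :=
  ∀ (D : Subsemigroup A) (s : A), (D : Set A).Nonempty → (∀ d ∈ D, s * d ∈ D) → s ∈ D

/-! ### Cube-term blockers and the two-element semilattice -/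

section Blockers

variable {A : Type u} [Mul A]

/-- The leftmost variable of a term blocks: an entry from `D` there is absorbed by every later
product. -/
theorem isCubeTermBlocker_of_ideal {D S : Subsemigroup A} (hD : (D : Set A).Nonempty)
    (hDS : D < S) (hl : ∀ d ∈ D, ∀ s ∈ S, d * s ∈ D) : IsCubeTermBlocker A D S where
  nonempty := hD
  lt := hDS
  blocks n t := by
    induction t using FreeMagma.recOnMul with
    | ih1 i => exact ⟨i, fun s _ h => h⟩
    | ih2 p q hp _ =>
      obtain ⟨i, hi⟩ := hp
      exact ⟨i, fun s hs h => hl _ (hi s hs h) _ (Term.eval_mem S q hs)⟩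

/-- The least element of `S2`. -/
def S2.zero : S2 := (0 : Fin 2)

/-- The greatest element of `S2`. -/
def S2.one : S2 := (1 : Fin 2)

theorem S2.zero_ne_one : S2.zero ≠ S2.one :=
  show (0 : Fin 2) ≠ 1 by decide

theorem S2.zero_mul (a : S2) : S2.zero * a = S2.zero :=
  (show ∀ a : Fin 2, min 0 a = 0 by decide) a

theorem S2.one_mul (a : S2) : S2.one * a = a :=
  (show ∀ a : Fin 2, min 1 a = a by decide) a

theorem S2.mul_mul_mul_comm (a b c d : S2) : a * b * (c * d) = a * c * (b * d) :=
  (show ∀ a b c d : Fin 2, min (min a b) (min c d) = min (min a c) (min b d) by decide) a b c d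

theorem S2.eq_zero_or_one (a : S2) : a = S2.zero ∨ a = S2.one :=
  (show ∀ a : Fin 2, a = 0 ∨ a = 1 by decide) a

theorem hasCubeTermBlocker_of_inHS (h : InHS A S2) : HasCubeTermBlocker A := by
  obtain ⟨S, f, hf⟩ := h
  let D₀ : Subsemigroup S :=
    { carrier := {a | f a = S2.zero}
      mul_mem' := fun {a b} ha _ => by
        change f (a * b) = _
        rw [map_mul, show f a = _ from ha, S2.zero_mul] }
  obtain ⟨d, hd⟩ := hf S2.zero
  obtain ⟨e, he⟩ := hf S2.one
  refine ⟨D₀.map (MulMemClass.subtype S), S, isCubeTermBlocker_of_ideal ⟨d, d, hd, rfl⟩ ?_ ?_⟩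
  · refine lt_of_le_of_ne ?_ ?_
    · rintro _ ⟨a, -, rfl⟩
      exact a.2
    · intro heq
      have : (e : A) ∈ D₀.map (MulMemClass.subtype S) := heq.ge e.2
      obtain ⟨a, ha, hae⟩ := this
      have : a = e := Subtype.ext hae
      subst this
      exact S2.zero_ne_one ((show f a = _ from ha).symm.trans he)
  · rintro _ ⟨a, ha, rfl⟩ s hs
    refine ⟨a * ⟨s, hs⟩, ?_, rfl⟩
    change f (a * ⟨s, hs⟩) = _
    rw [map_mul, show f a = _ from ha, S2.zero_mul]

theorem HasCubeTermBlocker.not_semilatticeFree (hcomm : ∀ x y : A, x * y = y * x)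
    (h : HasCubeTermBlocker A) : ¬ SemilatticeFree A := by
  obtain ⟨D, S, hB⟩ := h
  intro hA
  obtain ⟨s, hsS, hsD⟩ := SetLike.exists_of_lt hB.lt
  -- Blocking the basic operation alone makes `D` absorb `s` from one side, and commutativity makes
  -- the side irrelevant.
  obtain ⟨i, hi⟩ := hB.blocks 2 (FreeMagma.of 0 * FreeMagma.of 1)
  refine hsD (hA D s hB.nonempty fun d hd => ?_)
  have hdS := hB.lt.le hd
  fin_cases i
  · have := hi ![d, s] (by intro j; fin_cases j <;> assumption) hd
    rw [hcomm]
    exact this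
  · exact hi ![s, d] (by intro j; fin_cases j <;> assumption) hd

/-- A failure gives the subalgebra `D ∪ {s}`, which maps onto `S2` by sending `D` to 0 and `s` to 1.
-/
theorem inHS_S2_of_not_semilatticeFree (hcomm : ∀ x y : A, x * y = y * x)
    (hidem : ∀ x : A, x * x = x) (h : ¬ SemilatticeFree A) : InHS A S2 := by
  classical
  unfold SemilatticeFree at h
  push Not at h
  obtain ⟨D, s, ⟨d, hd⟩, hsD, hs⟩ := h
  have hDs : ∀ d ∈ D, d * s ∈ D := fun d hd => hcomm s d ▸ hsD d hd
  let S : Subsemigroup A :=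
    { carrier := {a | a ∈ D ∨ a = s}
      mul_mem' := by
        rintro a b (ha | rfl) (hb | rfl)
        · exact Or.inl (D.mul_mem ha hb)
        · exact Or.inl (hDs a ha)
        · exact Or.inl (hsD b hb)
        · exact Or.inr (hidem _) }
  let g : A → S2 := fun a => if a ∈ D then S2.zero else S2.one
  have g0 : ∀ a ∈ D, g a = S2.zero := fun a ha => if_pos ha
  have g1 : g s = S2.one := if_neg hs
  let f : S →ₙ* S2 :=
    { toFun := fun a => g a
      map_mul' := by
        rintro ⟨a, ha⟩ ⟨b, hb⟩
        change g (a * b) = g a * g b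
        rcases ha with ha | rfl
        · rw [g0 a ha, S2.zero_mul]
          refine g0 _ ?_
          rcases hb with hb | rfl
          exacts [D.mul_mem ha hb, hDs a ha]
        · rw [g1, S2.one_mul]
          rcases hb with hb | rfl
          · rw [g0 b hb, g0 _ (hsD b hb)]
          · rw [hidem] }
  refine ⟨S, f, fun b => ?_⟩
  rcases S2.eq_zero_or_one b with rfl | rfl
  exacts [⟨⟨d, Or.inl hd⟩, g0 d hd⟩, ⟨⟨s, Or.inr rfl⟩, g1⟩]

/-- Every position carries `y` in some edge identity. Taking the identity for the blocked position,
with `y` in `D` and `x` in `S \ D`, forces `x` into `D`. -/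
theorem HasEdgeTerm.not_hasCubeTermBlocker (h : HasEdgeTerm A) : ¬ HasCubeTermBlocker A := by
  rintro ⟨D, S, hB⟩
  obtain ⟨k, t, ht⟩ := h
  obtain ⟨s, hsS, hsD⟩ := SetLike.exists_of_lt hB.lt
  obtain ⟨d, hd⟩ := hB.nonempty
  obtain ⟨i, hi⟩ := hB.blocks _ t
  have key : ∀ (P : Fin (k + 1) → Prop) [DecidablePred P], P i →
      t.eval (fun j => if P j then d else s) ≠ s := by
    intro P _ hP heq
    refine hsD (heq ▸ hi _ (fun j => ?_) ?_)
    · split_ifs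
      exacts [hB.lt.le hd, hsS]
    · rwa [if_pos hP]
  by_cases h1 : i.val = 0 ∨ i.val = 1
  · exact key _ h1 (ht.first s d)
  by_cases h2 : i.val = 0 ∨ i.val = 2
  · exact key _ h2 (ht.second s d)
  · exact key (fun j => j = i) rfl (ht.rest i (by omega) s d)

end Blockers

/-! ### From semilattice-freeness to a Maltsev term -/

section Maltsev

variable {A : Type u} [Mul A]

/-- Elements of `D` are made to agree with `s` one coordinate at a time. Multiplying by `s`
preserves, by idempotence, the agreement already reached, so `A` itself supplies the next
coordinate. -/
theorem SemilatticeFree.pi (hA : SemilatticeFree A) (hidem : ∀ x : A, x * x = x)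
    {Q : Type v} [Finite Q] : SemilatticeFree (Q → A) := by
  classical
  intro D s hD hs
  have key : ∀ T : Set Q, T.Finite → ∃ d ∈ D, ∀ q ∈ T, d q = s q := by
    intro T hT
    induction T, hT using Set.Finite.induction_on with
    | empty =>
      obtain ⟨d, hd⟩ := hD
      exact ⟨d, hd, fun q hq => hq.elim⟩
    | @insert q T _ _ ih =>
      let E : Subsemigroup A :=
        { carrier := {a | ∃ d ∈ D, (∀ r ∈ T, d r = s r) ∧ d q = a}
          mul_mem' := by
            rintro _ _ ⟨d, hd, hdT, rfl⟩ ⟨e, he, heT, rfl⟩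
            refine ⟨d * e, D.mul_mem hd he, fun r hr => ?_, rfl⟩
            rw [Pi.mul_apply, hdT r hr, heT r hr, hidem] }
      obtain ⟨d, hd, hdT⟩ := ih
      obtain ⟨e, he, heT, heq⟩ : s q ∈ E := by
        refine hA E (s q) ⟨d q, d, hd, hdT, rfl⟩ ?_
        rintro _ ⟨e, he, heT, rfl⟩
        refine ⟨s * e, hs e he, fun r hr => ?_, rfl⟩
        rw [Pi.mul_apply, heT r hr, hidem]
      refine ⟨e, he, ?_⟩
      rintro r (rfl | hr)
      exacts [heq, heT r hr]
  obtain ⟨d, hd, hds⟩ := key Set.univ Set.finite_univ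
  rwa [← funext fun q => hds q trivial]

theorem SemilatticeFree.subsemigroup (hA : SemilatticeFree A) (B : Subsemigroup A) :
    SemilatticeFree B := by
  intro D s hD hs
  obtain ⟨a, ha, has⟩ := hA (D.map (MulMemClass.subtype B)) s
    (by obtain ⟨d, hd⟩ := hD; exact ⟨d, d, hd, rfl⟩)
    (by rintro _ ⟨d, hd, rfl⟩; exact ⟨s * d, hs d hd, rfl⟩)
  rwa [← Subtype.ext (a1 := a) (a2 := s) has]

/-- A subalgebra `Z` of the square of a finite commutative idempotent semilattice-free binar is the whole
square as soon as it contains a full row and the corresponding full column. -/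
theorem SemilatticeFree.mem_of_cross [Finite A] (hA : SemilatticeFree A)
    (hcomm : ∀ x y : A, x * y = y * x) (hidem : ∀ x : A, x * x = x) (Z : Subsemigroup (A × A)) (y : A)
    (hrow : ∀ w, (y, w) ∈ Z) (hcol : ∀ w, (w, y) ∈ Z) (a b : A) : (a, b) ∈ Z := by
  let N : A → Subsemigroup A := fun z =>
    { carrier := {w | (z, w) ∈ Z}
      mul_mem' := fun {v w} hv hw => by
        have h := Z.mul_mem hv hw
        rwa [Prod.mk_mul_mk, hidem] at h }
  have hN : ∀ {z u v w : A}, v ∈ N z → w ∈ N u → v * w ∈ N (z * u) :=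
    fun hv hw => Z.mul_mem hv hw
  let G : Subsemigroup A :=
    { carrier := {u | ∀ w, w ∈ N u}
      mul_mem' := fun {u v} hu hv w => by
        have h := hN (hu w) (hv w)
        rwa [hidem] at h }
  by_contra hab
  have hne : {z : A | z ∉ G}.Nonempty := ⟨a, fun h => hab (h b)⟩
  -- Take a non-full fibre `N z` that is maximal. If `z * G ⊆ G` then `z ∈ G`; otherwise some `u ∈
  -- G` has `z * u ∉ G`, and `N z ≤ N (z * u)`.
  obtain ⟨z, hz, hmax⟩ := (Set.toFinite {z : A | z ∉ G}).exists_maximalFor N _ hne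
  refine hz (hA G z ⟨y, hrow⟩ fun u hu => ?_)
  by_contra hzu
  have hle : N (z * u) ≤ N z := hmax hzu fun v hv => by
    have h := hN hv (hu v)
    rwa [hidem] at h
  -- As `N u` is everything, `N z * A ⊆ N (z * u) ≤ N z`. So every `s` is absorbed into `N z` and
  -- hence lies in it, making the fibre full.
  refine hz fun s => hA (N z) s ⟨y, hcol z⟩ fun v hv => ?_
  rw [hcomm]
  exact hle (hN hv (hu s))

/-- A term operation `t` with `t(y,y,x) = x = t(y,x,y)` makes a binar have an edge term. -/
theorem hasEdgeTerm_of_maltsev {t : Term 3} (h₁ : ∀ x y : A, t.eval ![y, y, x] = x)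
    (h₂ : ∀ x y : A, t.eval ![y, x, y] = x) : HasEdgeTerm A := by
  refine ⟨2, t, by norm_num, fun x y => ?_, fun x y => ?_, fun j hj => by omega⟩
  · convert h₁ x y using 2
    funext i
    fin_cases i <;> rfl
  · convert h₂ x y using 2
    funext i
    fin_cases i <;> rfl

theorem SemilatticeFree.exists_maltsev [Finite A] (hA : SemilatticeFree A)
    (hcomm : ∀ x y : A, x * y = y * x) (hidem : ∀ x : A, x * x = x) :
    ∃ t : Term 3, (∀ x y : A, t.eval ![y, y, x] = x) ∧ ∀ x y : A, t.eval ![y, x, y] = x := by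
  let x : A × A → A := Prod.fst
  let y : A × A → A := Prod.snd
  have hidemE : ∀ f : A × A → A, f * f = f := fun f => funext fun q => hidem _
  let B : Subsemigroup (A × A → A) := (FreeMagma.lift ![x, y]).srange
  let xB : B := ⟨x, FreeMagma.of 0, rfl⟩
  let yB : B := ⟨y, FreeMagma.of 1, rfl⟩
  let Z : Subsemigroup (B × B) :=
    { carrier := {p | ∃ t : Term 3, t.eval ![y, y, x] = p.1 ∧ t.eval ![y, x, y] = p.2}
      mul_mem' := by
        rintro ⟨a, b⟩ ⟨c, d⟩ ⟨s, hs₁, hs₂⟩ ⟨t, ht₁, ht₂⟩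
        refine ⟨s * t, ?_, ?_⟩
        · rw [Term.eval_mul, hs₁, ht₁]; rfl
        · rw [Term.eval_mul, hs₂, ht₂]; rfl }
  have hrow : ∀ w, (yB, w) ∈ Z := by
    rintro ⟨_, s, rfl⟩
    -- The second and first variables have values `(y, x)` and `(y, y)` in `B × B`, so `s` collapses
    -- to `y` in the first component and is `s(x, y)` in the second.
    refine ⟨Term.eval s ![FreeMagma.of 1, FreeMagma.of 0], ?_, ?_⟩
    · rw [Term.eval_subst]
      refine (congrArg (Term.eval s) (funext fun i => ?_)).trans (Term.eval_const hidemE s y)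
      fin_cases i <;> rfl
    · rw [Term.eval_subst]
      refine congrArg (Term.eval s) (funext fun i => ?_)
      fin_cases i <;> rfl
  have hcol : ∀ w, (w, yB) ∈ Z := by
    rintro ⟨_, s, rfl⟩
    refine ⟨Term.eval s ![FreeMagma.of 2, FreeMagma.of 0], ?_, ?_⟩
    · rw [Term.eval_subst]
      refine congrArg (Term.eval s) (funext fun i => ?_)
      fin_cases i <;> rfl
    · rw [Term.eval_subst]
      refine (congrArg (Term.eval s) (funext fun i => ?_)).trans (Term.eval_const hidemE s y)
      fin_cases i <;> rfl
  obtain ⟨t, ht₁, ht₂⟩ := ((hA.pi hidem).subsemigroup B).mem_of_cross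
    (fun a b => Subtype.ext (funext fun q => hcomm _ _)) (fun b => Subtype.ext (hidemE b)) Z yB hrow hcol xB xB
  refine ⟨t, fun a b => ?_, fun a b => ?_⟩
  · have h := congrFun ht₁ (a, b)
    rw [Term.eval_apply] at h
    refine (congrArg t.eval (funext fun i => ?_)).trans h
    fin_cases i <;> rfl
  · have h := congrFun ht₂ (a, b)
    rw [Term.eval_apply] at h
    refine (congrArg t.eval (funext fun i => ?_)).trans h
    fin_cases i <;> rfl

end Maltsev

/-! ### Congruence modularity -/

section Modularity

/-- Maltsev's argument: congruences permute, so joins are relational products, and the modular law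
can be checked on the single intermediate element. -/
theorem isModularLattice_con {B : Type v} [Mul B] (t : Term 3)
    (h₁ : ∀ x y : B, t.eval ![y, y, x] = x) (h₂ : ∀ x y : B, t.eval ![y, x, y] = x) :
    IsModularLattice (Con B) := by
  have hperm : ∀ (c d : Con B) {a b e : B}, c a b → d b e → ∃ m, d a m ∧ c m e := by
    intro c d a b e hab hbe
    refine ⟨t.eval ![b, a, e], ?_, ?_⟩
    · have h : d (t.eval ![b, a, b]) (t.eval ![b, a, e]) :=
        Term.eval_con d t fun i => by
          fin_cases i
          exacts [d.refl _, d.refl _, hbe]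
      rwa [h₂] at h
    · have h : c (t.eval ![b, a, e]) (t.eval ![b, b, e]) :=
        Term.eval_con c t fun i => by
          fin_cases i
          exacts [c.refl _, hab, c.refl _]
      rwa [h₁] at h
  have hsup : ∀ (c d : Con B) {a b : B}, (c ⊔ d) a b → ∃ m, c a m ∧ d m b := by
    intro c d a b hab
    let r : Con B :=
      { r := fun a b => ∃ m, c a m ∧ d m b
        iseqv :=
          { refl := fun a => ⟨a, c.refl a, d.refl a⟩
            symm := fun ⟨_, hm, hm'⟩ => hperm d c (d.symm hm') (c.symm hm)
            trans := by
              rintro a b e ⟨m, hm, hm'⟩ ⟨k, hk, hk'⟩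
              obtain ⟨l, hl, hl'⟩ := hperm d c hm' hk
              exact ⟨l, c.trans hm hl, d.trans hl' hk'⟩ }
        mul' := fun ⟨_, hm, hm'⟩ ⟨_, hk, hk'⟩ => ⟨_, c.mul hm hk, d.mul hm' hk'⟩ }
    have hle : c ⊔ d ≤ r :=
      sup_le (fun {a b} h => ⟨b, h, d.refl b⟩) (fun {a b} h => ⟨a, c.refl a, h⟩)
    exact hle hab
  refine ⟨fun {c} d {e} hce => ?_⟩
  intro a b hab
  obtain ⟨hab₁, hab₂⟩ := hab
  obtain ⟨m, hm, hm'⟩ := hsup c d hab₁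
  have hmb : (d ⊓ e) m b := ⟨hm', e.trans (e.symm (hce hm)) hab₂⟩
  exact (c ⊔ d ⊓ e).trans ((le_sup_left : c ≤ c ⊔ d ⊓ e) hm)
    ((le_sup_right : d ⊓ e ≤ c ⊔ d ⊓ e) hmb)

variable {A : Type u} [Mul A]

/-- Identities between terms pass from `A` to the variety that it generates. -/
theorem InVariety.eval_eq {B : Type v} [Mul B] (hB : InVariety.{u, v} A B) {n : ℕ} {s t : Term n}
    (h : ∀ a : Fin n → A, s.eval a = t.eval a) (b : Fin n → B) : s.eval b = t.eval b := by
  obtain ⟨I, S, f, hf⟩ := hB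
  choose g hg using hf
  have hS : ∀ a : Fin n → S, s.eval a = t.eval a := by
    intro a
    apply Subtype.ext
    have hs := Term.map_eval (MulMemClass.subtype S) s a
    have ht := Term.map_eval (MulMemClass.subtype S) t a
    refine hs.trans (Eq.trans ?_ ht.symm)
    funext i
    rw [Term.eval_apply, Term.eval_apply]
    exact h _
  have hb : b = fun i => f (g (b i)) := funext fun i => (hg _).symm
  rw [hb, ← Term.map_eval f, ← Term.map_eval f, hS]

theorem varietyIsCongruenceModular_of_maltsev {t : Term 3}
    (h₁ : ∀ x y : A, t.eval ![y, y, x] = x) (h₂ : ∀ x y : A, t.eval ![y, x, y] = x) :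
    VarietyIsCongruenceModular.{u, v} A := by
  intro B _ hB
  refine isModularLattice_con t (fun x y => ?_) (fun x y => ?_)
  · have h := hB.eval_eq (s := Term.eval t ![FreeMagma.of 1, FreeMagma.of 1, FreeMagma.of 0])
      (t := (FreeMagma.of 0 : Term 2)) (fun a => ?_) ![x, y]
    · rw [Term.eval_subst] at h
      refine (congrArg t.eval (funext fun i => ?_)).trans h
      fin_cases i <;> rfl
    · rw [Term.eval_subst]
      refine (congrArg t.eval (funext fun i => ?_)).trans (h₁ (a 0) (a 1))
      fin_cases i <;> rfl
  · have h := hB.eval_eq (s := Term.eval t ![FreeMagma.of 1, FreeMagma.of 0, FreeMagma.of 1])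
      (t := (FreeMagma.of 0 : Term 2)) (fun a => ?_) ![x, y]
    · rw [Term.eval_subst] at h
      refine (congrArg t.eval (funext fun i => ?_)).trans h
      fin_cases i <;> rfl
    · rw [Term.eval_subst]
      refine (congrArg t.eval (funext fun i => ?_)).trans (h₂ (a 0) (a 1))
      fin_cases i <;> rfl

theorem inVariety_ulift_S2_prod_S2 (h : InHS A S2) :
    InVariety.{u, v} A (ULift.{v} (S2 × S2)) := by
  obtain ⟨S, f, hf⟩ := h
  let T : Subsemigroup (ULift.{max u v} Bool → A) :=
    { carrier := {a | ∀ i, a i ∈ S}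
      mul_mem' := fun ha hb i => S.mul_mem (ha i) (hb i) }
  let g : T →ₙ* ULift.{v} (S2 × S2) :=
    { toFun := fun a => ⟨f ⟨a.1 ⟨true⟩, a.2 _⟩, f ⟨a.1 ⟨false⟩, a.2 _⟩⟩
      map_mul' := fun a b => by
        apply ULift.ext
        exact Prod.ext (map_mul f ⟨a.1 ⟨true⟩, a.2 _⟩ ⟨b.1 ⟨true⟩, b.2 _⟩)
          (map_mul f ⟨a.1 ⟨false⟩, a.2 _⟩ ⟨b.1 ⟨false⟩, b.2 _⟩) }
  refine ⟨ULift.{max u v} Bool, T, g, ?_⟩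
  rintro ⟨p, q⟩
  obtain ⟨a, rfl⟩ := hf p
  obtain ⟨b, rfl⟩ := hf q
  refine ⟨⟨fun i => if i.down then a else b, fun i => ?_⟩, rfl⟩
  dsimp only
  split_ifs
  exacts [a.2, b.2]

/-- There is a pentagon: `γ < α` with `β ⊓ α` trivial, while the chain `(1,0) β (0,0) γ (0,1) β
(1,1)` puts the `α`-pair `(1,0), (1,1)` in `γ ⊔ β` but not in `γ`. -/
theorem not_isModularLattice_con_ulift_S2_prod_S2 :
    ¬ IsModularLattice (Con (ULift.{v} (S2 × S2))) := by
  intro hmod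
  let α : Con (ULift.{v} (S2 × S2)) :=
    Con.ker (⟨fun p => p.down.1, fun _ _ => rfl⟩ : ULift.{v} (S2 × S2) →ₙ* S2)
  let β : Con (ULift.{v} (S2 × S2)) :=
    Con.ker (⟨fun p => p.down.2, fun _ _ => rfl⟩ : ULift.{v} (S2 × S2) →ₙ* S2)
  -- The map `(a, b) ↦ (a, a ∧ b)` identifies only `(0,0)` and `(0,1)`.
  let γ : Con (ULift.{v} (S2 × S2)) :=
    Con.ker (⟨fun p => (p.down.1, p.down.1 * p.down.2), fun p q => Prod.ext rfl
      (S2.mul_mul_mul_comm _ _ _ _)⟩ : ULift.{v} (S2 × S2) →ₙ* S2 × S2)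
  have hγα : γ ≤ α := fun {p q} h => (Prod.mk.inj
    (show (p.down.1, p.down.1 * p.down.2) = (q.down.1, q.down.1 * q.down.2) from h)).1
  have hβα : β ⊓ α ≤ γ := by
    rintro p q ⟨hβ, hα⟩
    rw [ULift.ext p q (Prod.ext hα hβ)]
    exact γ.refl q
  have hle : (γ ⊔ β) ⊓ α ≤ γ :=
    (hmod.sup_inf_le_assoc_of_le β hγα).trans (sup_le le_rfl hβα)
  have h₁ : β ⟨S2.one, S2.zero⟩ ⟨S2.zero, S2.zero⟩ := rfl
  have h₂ : γ ⟨S2.zero, S2.zero⟩ ⟨S2.zero, S2.one⟩ := rfl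
  have h₃ : β ⟨S2.zero, S2.one⟩ ⟨S2.one, S2.one⟩ := rfl
  have hβ : β ≤ γ ⊔ β := le_sup_right
  have hγ : γ ≤ γ ⊔ β := le_sup_left
  have h₄ : γ ⟨S2.one, S2.zero⟩ ⟨S2.one, S2.one⟩ :=
    hle ⟨(γ ⊔ β).trans (hβ h₁) ((γ ⊔ β).trans (hγ h₂) (hβ h₃)), rfl⟩
  exact S2.zero_ne_one (congrArg Prod.snd (show (S2.one, S2.zero) = (S2.one, S2.one) from h₄))

end Modularity

end Binar

theorem mainTheorem6 (A : Type u) [Mul A] [Finite A]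
    (hcomm : ∀ x y : A, x * y = y * x) (hidem : ∀ x : A, x * x = x) :
    [Binar.HasEdgeTerm A,
      Binar.VarietyIsCongruenceModular.{u, v} A,
      ¬ Binar.InHS A Binar.S2].TFAE ∧
    (Binar.HasCubeTermBlocker A ↔ Binar.InHS A Binar.S2) := by
  have hfree : ¬ Binar.InHS A Binar.S2 → Binar.SemilatticeFree A := fun h =>
    not_not.1 (mt (Binar.inHS_S2_of_not_semilatticeFree hcomm hidem) h)
  refine ⟨?_, fun h => Binar.inHS_S2_of_not_semilatticeFree hcomm hidem
    (h.not_semilatticeFree hcomm), Binar.hasCubeTermBlocker_of_inHS⟩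
  tfae_have 1 → 3 := fun h hS =>
    h.not_hasCubeTermBlocker (Binar.hasCubeTermBlocker_of_inHS hS)
  tfae_have 3 → 1 := fun h => by
    obtain ⟨t, h₁, h₂⟩ := (hfree h).exists_maltsev hcomm hidem
    exact Binar.hasEdgeTerm_of_maltsev h₁ h₂
  tfae_have 3 → 2 := fun h => by
    obtain ⟨t, h₁, h₂⟩ := (hfree h).exists_maltsev hcomm hidem
    exact Binar.varietyIsCongruenceModular_of_maltsev h₁ h₂
  tfae_have 2 → 3 := fun h hS =>
    Binar.not_isModularLattice_con_ulift_S2_prod_S2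
      (h _ (Binar.inVariety_ulift_S2_prod_S2 hS))
  tfae_finish
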